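/- **Model.** Let $n$ nodes be placed independently and uniformly on a sphere of area $n$ (all distances are measured along the surface), and let each node choose its destination independently and uniformly among the other nodes. Let $\rho_n$ be the radius of a disk of area $100\log n$ on this sphere. The sphere is divided into Voronoi cells, each of which contains a disk of radius $\rho_n$ and lies in a disk of radius $2\rho_n$. *Scheduling policy $\pi_1$.* Fix a guard parameter $\Delta>0$ and a number of colours $K$, both independent of $n$. The cells are coloured with $K$ colours so that two distinct cells containing points at distance at most $(2+\Delta)\,8\rho_n$ have different colours. Time is slotted, the colours are served cyclically, and in a slot one node of every cell of the served colour transmits; a cell transmits at most one packet per slot. *Routing.* The packets of a source--destination pair are relayed from cell to neighbouring cell by the cells that the shortest surface path (straight line) from source to destination crosses, in this order, each such cell transmitting a packet at most once; any node of a relaying cell may act as the relay. All sources inject packets at a common rate $\lambda_n$ (packets per slot), which may depend on the deployment. *Links.* All nodes have the same power $P>0$, noise is neglected, and the path loss exponent is $\alpha>2$: when node $i$ transmits to node $j$ and $T$ is the set of simultaneously transmitting nodes, $\mathrm{SINR}=\dfrac{P\,|X_i-X_j|^{-\alpha}}{\sum_{k\in T,\,k\ne i}P\,|X_k-X_j|^{-\alpha}}$,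 where $X_k$ is the position of node $k$. The packet is then received with probability $\phi(\mathrm{SINR})$, independently over the hops (with $\phi(\infty)=1$ if there is no interferer), and a lost packet is not retransmitted. Here $\phi:[0,\infty)\to[0,1)$ is continuous and nondecreasing with $\phi(x)\to1$ as $x\to\infty$. The end-to-end throughput $\Lambda_n(i)$ of node $i$, given the deployment, is the long-run (upper limit) average number per slot of packets injected by $i$ that reach their destination, in expectation over the packet losses. **Proposition 3.** There is a constant $C$, depending only on $\alpha$, $\phi$, $\Delta$ and $K$, such that for all sufficiently large $n$, for every such tessellation and colouring, every $P>0$, every transmission plan as above (chosen depending on the deployment, and arbitrary if some cell contains no node), and every node $i$, $$\mathbf{E}[\Lambda_n(i)]\le \frac{C}{n},$$ the expectation being over the random positions and destinations. That is, the per-node throughput that can be achieved is $O(1/n)$. -/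

import Mathlib

open Filter MeasureTheory
open scoped ENNReal Topology

noncomputable section

/-! ### The sphere of area `n` -/

/-- Points of the sphere of area `n` are given by their direction, a unit vector of `ℝ³`. -/
abbrev Sph : Type := Metric.sphere (0 : EuclideanSpace ℝ (Fin 3)) 1

/-- Distance along the surface of the sphere of area `n`, whose radius is `√(n / (4π))`. -/
def surfDist (n : ℕ) (x y : Sph) : ℝ :=
  Real.sqrt ((n : ℝ) / (4 * Real.pi)) *
    InnerProductGeometry.angle (x : EuclideanSpace ℝ (Fin 3)) (y : EuclideanSpace ℝ (Fin 3))

/-- Surface area on the sphere of area `n` (`toSphere` is the surface measure of the unit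
sphere, of total mass `4π`). -/
def surfArea (n : ℕ) : Measure Sph :=
  ENNReal.ofReal ((n : ℝ) / (4 * Real.pi)) •
    (volume : Measure (EuclideanSpace ℝ (Fin 3))).toSphere

/-- The disk with centre `x` and radius `r`, measured along the surface. -/
def disk (n : ℕ) (x : Sph) (r : ℝ) : Set Sph := {y | surfDist n x y ≤ r}

/-- `ρ` is the radius of a disk of area `A` on the sphere of area `n`. -/
def IsDiskRadius (n : ℕ) (A ρ : ℝ) : Prop :=
  0 ≤ ρ ∧ ∀ x : Sph, surfArea n (disk n x ρ) = ENNReal.ofReal A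

/-- The straight line (shortest path along the surface) from `x` to `y`. -/
def straightLine (n : ℕ) (x y : Sph) : Set Sph :=
  {z | surfDist n x z + surfDist n z y = surfDist n x y}

/-! ### Random deployment -/

/-- The uniform distribution on the sphere. -/
def uniformSph : Measure Sph :=
  ProbabilityTheory.cond (volume : Measure (EuclideanSpace ℝ (Fin 3))).toSphere Set.univ

/-- The positions of the `n` nodes and the destination of each node. -/
abbrev Deployment (n : ℕ) : Type := (Fin n → Sph) × (Fin n → Fin n)

/-- The nodes are placed independently and uniformly on the sphere, and each node picks its
destination independently and uniformly among the other nodes. -/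
def deploymentLaw (n : ℕ) : Measure (Deployment n) :=
  (Measure.pi fun _ : Fin n => uniformSph).prod
    (Measure.pi fun i : Fin n => ProbabilityTheory.uniformOn {j : Fin n | j ≠ i})

/-! ### Tessellation and colouring -/

/-- The closed Voronoi cell of the `a`-th generator. -/
def voronoiCell (n : ℕ) {m : ℕ} (p : Fin m → Sph) (a : Fin m) : Set Sph :=
  {x | ∀ b, surfDist n x (p a) ≤ surfDist n x (p b)}

/-- A Voronoi tessellation each of whose cells contains a disk of radius `ρ` and is contained in
a disk of radius `2ρ`. -/
def IsTessellation (n : ℕ) (ρ : ℝ) {m : ℕ} (p : Fin m → Sph) : Prop :=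
  Function.Injective p ∧
    ∀ a, (∃ x, disk n x ρ ⊆ voronoiCell n p a) ∧ (∃ y, voronoiCell n p a ⊆ disk n y (2 * ρ))

/-- Two distinct cells are interfering neighbours if a point of one is within distance
`(2 + Δ) r` of a point of the other, where `r = 8ρ` is the communication radius; interfering
neighbours receive different colours. -/
def IsInterferenceColoring (n : ℕ) (ρ Δ : ℝ) {m K : ℕ} (p : Fin m → Sph)
    (color : Fin m → Fin K) : Prop :=
  ∀ a b, a ≠ b →
    (∃ x ∈ voronoiCell n p a, ∃ y ∈ voronoiCell n p b, surfDist n x y ≤ (2 + Δ) * (8 * ρ)) →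
    color a ≠ color b

/-! ### Slotted operation of the network

Colour `t % K` is served in slot `t`. A packet is identified by its connection (its source `i`)
and the slot `s` in which the source injects it, that is, transmits it for the first time. -/

/-- The raw data of a transmission plan for `n` nodes and `m` cells. -/
structure Plan (n m : ℕ) where
  /-- the cell to which a node belongs -/
  home : Fin n → Fin m
  /-- `tx t a` is the node of cell `a` that transmits in slot `t`, if cell `a` is served then -/
  tx : ℕ → Fin m → Fin n
  /-- the slots in which source `i` injects a packet -/
  inj : Fin n → Set ℕ
  /-- the common injection rate, in packets per slot -/
  rate : ℝ
  /-- the number of hops of packet `(i, s)` -/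
  hops : Fin n → ℕ → ℕ
  /-- `relay i s k` transmits packet `(i, s)` on hop `k`, and `relay i s (k + 1)` receives it -/
  relay : Fin n → ℕ → ℕ → Fin n
  /-- the slot in which hop `k` of packet `(i, s)` takes place -/
  slot : Fin n → ℕ → ℕ → ℕ

/-- Straight-line routing of a packet from node `i` to node `d` along the nodes
`v 0, …, v H`: the line from `i` to `d` crosses over from the cell of `v k` to that of
`v (k + 1)` at the point `z k`; each cell through which the line passes takes part, and no
cell transmits the packet twice. (If `i` and `d` share a cell, there is a single hop.) -/
def IsStraightLineRoute {n m : ℕ} (p : Fin m → Sph) (X : Fin n → Sph) (home : Fin n → Fin m)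
    (i d : Fin n) (H : ℕ) (v : ℕ → Fin n) : Prop :=
  v 0 = i ∧ v H = d ∧
  (∀ k < H, ∀ l < H, home (v k) = home (v l) → k = l) ∧
  (∀ a, (interior (voronoiCell n p a) ∩ straightLine n (X i) (X d)).Nonempty →
    ∃ k ≤ H, home (v k) = a) ∧
  ∃ z : ℕ → Sph,
    (∀ k < H, z k ∈ voronoiCell n p (home (v k)) ∩ voronoiCell n p (home (v (k + 1))) ∩
      straightLine n (X i) (X d)) ∧
    (∀ k l, k ≤ l → l < H → surfDist n (X i) (z k) ≤ surfDist n (X i) (z l))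

/-- The plan `S` obeys the colouring schedule and straight-line routing in the deployment `ω`. -/
structure Plan.Obeys {n m K : ℕ} (S : Plan n m) (p : Fin m → Sph) (color : Fin m → Fin K)
    (ω : Deployment n) : Prop where
  /-- nodes belong to the cells in which they lie -/
  home_mem : ∀ j, ω.1 j ∈ voronoiCell n p (S.home j)
  /-- in slot `t`, one node of every cell of colour `t % K` transmits -/
  tx_home : ∀ t a, (color a : ℕ) = t % K → S.home (S.tx t a) = a
  /-- all sources inject packets at the same rate -/
  inj_rate : ∀ i, Tendsto (fun T : ℕ =>
    (∑ s ∈ Finset.range T, (S.inj i).indicator (fun _ => (1 : ℝ)) s) / T) atTop (𝓝 S.rate)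
  /-- packets are routed along straight lines -/
  route : ∀ i, ∀ s ∈ S.inj i,
    IsStraightLineRoute p ω.1 S.home i (ω.2 i) (S.hops i s) (S.relay i s)
  /-- the first hop takes place in the slot of injection -/
  slot_zero : ∀ i, ∀ s ∈ S.inj i, S.slot i s 0 = s
  /-- the hops of a packet take place one after the other -/
  slot_lt : ∀ i, ∀ s ∈ S.inj i, ∀ k, k + 1 < S.hops i s → S.slot i s k < S.slot i s (k + 1)
  /-- a hop takes place in a slot that serves the cell of its transmitter -/
  slot_color : ∀ i, ∀ s ∈ S.inj i, ∀ k < S.hops i s,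
    (color (S.home (S.relay i s k)) : ℕ) = S.slot i s k % K
  /-- the transmitter of a hop is the transmitting node of its cell in that slot -/
  tx_eq : ∀ i, ∀ s ∈ S.inj i, ∀ k < S.hops i s,
    S.tx (S.slot i s k) (S.home (S.relay i s k)) = S.relay i s k
  /-- a cell transmits at most one packet per slot -/
  single : ∀ i, ∀ s ∈ S.inj i, ∀ k < S.hops i s, ∀ i', ∀ s' ∈ S.inj i', ∀ k' < S.hops i' s',
    S.slot i s k = S.slot i' s' k' →
    S.home (S.relay i s k) = S.home (S.relay i' s' k') → i = i' ∧ s = s' ∧ k = k'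

/-! ### Physical layer and throughput -/

/-- Power received at distance `surfDist n x y`; infinite at distance `0`. -/
def rxPower (n : ℕ) (P α : ℝ) (x y : Sph) : ℝ≥0∞ :=
  ENNReal.ofReal P / ENNReal.ofReal (surfDist n x y) ^ α

/-- The nodes that transmit in slot `t`. -/
def Plan.transmitters {n m K : ℕ} (S : Plan n m) (color : Fin m → Fin K) (t : ℕ) :
    Finset (Fin n) :=
  (Finset.univ.filter fun a => (color a : ℕ) = t % K).image (S.tx t)

/-- The SINR, with negligible noise, at node `j` of the transmission of node `i`, when the set
of all transmitting nodes is `T`. It is infinite if there is no interferer. -/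
def sinr {n : ℕ} (P α : ℝ) (X : Fin n → Sph) (T : Finset (Fin n)) (i j : Fin n) : ℝ≥0∞ :=
  rxPower n P α (X i) (X j) / ∑ k ∈ T.erase i, rxPower n P α (X k) (X j)

/-- The success probability of a link, `φ(SINR)`, with `φ(∞) = 1`. -/
def linkSuccess (φ : ℝ → ℝ) (s : ℝ≥0∞) : ℝ := if s = ⊤ then 1 else φ s.toReal

/-- The probability that packet `(i, s)` is received on all its hops; receptions on different
hops are independent. -/
def Plan.packetSuccess {n m K : ℕ} (S : Plan n m) (φ : ℝ → ℝ) (P α : ℝ)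
    (color : Fin m → Fin K) (X : Fin n → Sph) (i : Fin n) (s : ℕ) : ℝ :=
  ∏ k ∈ Finset.range (S.hops i s),
    linkSuccess φ (sinr P α X (S.transmitters color (S.slot i s k))
      (S.relay i s k) (S.relay i s (k + 1)))

/-- The end-to-end throughput of node `i`: the long-run expected number, per slot, of packets
injected by `i` that reach their destination. -/
def Plan.throughput {n m K : ℕ} (S : Plan n m) (φ : ℝ → ℝ) (P α : ℝ)
    (color : Fin m → Fin K) (X : Fin n → Sph) (i : Fin n) : ℝ :=
  limsup (fun T : ℕ =>
    (∑ s ∈ Finset.range T, (S.inj i).indicator (S.packetSuccess φ P α color X i) s) / T) atTop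

end

/-!
On a long route, a packet is lost on each of a positive fraction of its hops with a probability
bounded away from zero, so the throughput decays exponentially in the distance from source to destination, and only
pairs at distance of order `ρ`, which have probability of order `log n / n`, contribute. The
injection rate is of order `1 / log n`, and the product is of order `1 / n`.

*Lossy hops.* A single hop may be arbitrarily short or free of interference. However, the cells of
a route are distinct and a disk of radius `5ρ` contains a bounded number of cells
(`card_cells_subset_disk_le`), so a bounded number of consecutive hops cannot all be short
(`exists_long_hop`). Among sufficiently many consecutive hops there are `K + 1` long ones, and two
of them start in cells of the same colour. When one of the two cells is served, so is the other,
whose transmitter is an interferer at distance `O(ρ)`. The SINR of that hop is thus bounded by a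
constant `B` (`sinr_le`), and its success probability by `β = φ B < 1` (`exists_lossy_hop`).

*Rate.* There are at most `n / (100 log n)` cells, so some cell contains at least `100 log n` nodes,
which share its slots (`rate_le`).

*Averaging.* Since every hop has length at most `8ρ`, a packet that passes fewer than `b + 1` blocks
of hops covers a distance of at most a constant times `(b + 1) ρ`. The area of a disk grows at most
quadratically in its radius (`surfArea_disk_mul_le`), so this has probability
`O((b + 1) ^ 2 log n / n)`, and `∑ (b + 1) ^ 2 β ^ b` converges (`lintegral_throughput_le`).
Deployments with an empty cell have probability at most `1 / n`, and there the throughput is at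
most one.
-/

/-! ### Surface distance and the area of disks -/

theorem surfDist_comm (n : ℕ) (x y : Sph) : surfDist n x y = surfDist n y x := by
  rw [surfDist, surfDist, InnerProductGeometry.angle_comm]

theorem surfDist_triangle (n : ℕ) (x y z : Sph) :
    surfDist n x z ≤ surfDist n x y + surfDist n y z := by
  rw [surfDist, surfDist, surfDist, ← mul_add]
  exact mul_le_mul_of_nonneg_left (InnerProductGeometry.angle_le_angle_add_angle _ _ _)
    (Real.sqrt_nonneg _)

theorem surfDist_self (n : ℕ) (x : Sph) : surfDist n x x = 0 := by
  rw [surfDist, InnerProductGeometry.angle_self (ne_zero_of_mem_unit_sphere x), mul_zero]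

theorem angle_eq_arccos (x y : Sph) :
    InnerProductGeometry.angle (x : EuclideanSpace ℝ (Fin 3)) y =
      Real.arccos (inner ℝ (x : EuclideanSpace ℝ (Fin 3)) y) := by
  rw [InnerProductGeometry.angle, norm_eq_of_mem_sphere, norm_eq_of_mem_sphere, mul_one, div_one]

theorem continuous_angle_sph : Continuous fun q : Sph × Sph =>
    InnerProductGeometry.angle (q.1 : EuclideanSpace ℝ (Fin 3)) q.2 := by
  simp only [angle_eq_arccos]
  exact Real.continuous_arccos.comp (Continuous.inner (continuous_subtype_val.comp continuous_fst)
    (continuous_subtype_val.comp continuous_snd))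

theorem continuous_surfDist (n : ℕ) : Continuous fun q : Sph × Sph => surfDist n q.1 q.2 :=
  continuous_const.mul continuous_angle_sph

theorem continuous_surfDist_left (n : ℕ) (y : Sph) : Continuous fun x => surfDist n x y := by
  have h : Continuous fun x : Sph => (x, y) := continuous_id.prodMk continuous_const
  have h' := (continuous_surfDist n).comp h
  exact h'

theorem isClosed_voronoiCell (n : ℕ) {m : ℕ} (p : Fin m → Sph) (a : Fin m) :
    IsClosed (voronoiCell n p a) := by
  have h : voronoiCell n p a = ⋂ b, {x | surfDist n x (p a) ≤ surfDist n x (p b)} := by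
    ext; simp [voronoiCell]
  rw [h]
  exact isClosed_iInter fun b => isClosed_le (continuous_surfDist_left n (p a))
    (continuous_surfDist_left n (p b))

/-- The volume of a box whose edges are parallel to the vectors of an orthonormal basis. -/
theorem volume_orthonormal_box
    (b : OrthonormalBasis (Fin 3) ℝ (EuclideanSpace ℝ (Fin 3))) (lo hi : Fin 3 → ℝ) :
    volume {z | ∀ i, lo i ≤ b.repr z i ∧ b.repr z i ≤ hi i} =
      ∏ i, ENNReal.ofReal (hi i - lo i) := by
  have h := (PiLp.volume_preserving_ofLp (Fin 3)).comp b.measurePreserving_repr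
  rw [← Real.volume_Icc_pi, ← h.measure_preimage measurableSet_Icc.nullMeasurableSet]
  congr 1
  ext z
  simp [Pi.le_def, forall_and]

theorem exists_orthonormalBasis_head (x : Sph) :
    ∃ b : OrthonormalBasis (Fin 3) ℝ (EuclideanSpace ℝ (Fin 3)), b 0 = x := by
  obtain ⟨b, hb⟩ := Orthonormal.exists_orthonormalBasis_extension_of_card_eq
    (𝕜 := ℝ) (E := EuclideanSpace ℝ (Fin 3)) (ι := Fin 3) (by simp)
    (v := fun _ => (x : EuclideanSpace ℝ (Fin 3))) (s := {0})
    (by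
      constructor
      · intro i; simp
      · rintro ⟨i, hi⟩ ⟨j, hj⟩ hij
        simp only [Set.mem_singleton_iff] at hi hj
        exact absurd (Subtype.ext (hi.trans hj.symm)) hij)
  exact ⟨b, hb 0 rfl⟩

/-- Pythagoras for the angle `θ` between `z` and the first basis vector: the remaining
coordinates of `z` have norm `‖z‖ sin θ`. -/
theorem sq_add_sq_eq_norm_mul_sin_sq
    (b : OrthonormalBasis (Fin 3) ℝ (EuclideanSpace ℝ (Fin 3))) (z : EuclideanSpace ℝ (Fin 3)) :
    b.repr z 1 ^ 2 + b.repr z 2 ^ 2 =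
      (‖z‖ * Real.sin (InnerProductGeometry.angle (b 0) z)) ^ 2 := by
  have h1 : ‖z‖ ^ 2 = b.repr z 0 ^ 2 + b.repr z 1 ^ 2 + b.repr z 2 ^ 2 := by
    rw [← b.repr.norm_map z, EuclideanSpace.norm_sq_eq, Fin.sum_univ_three]
    simp
  have h2 : ‖z‖ * Real.cos (InnerProductGeometry.angle (b 0) z) = b.repr z 0 := by
    have h := InnerProductGeometry.cos_angle_mul_norm_mul_norm (b 0) z
    rw [b.norm_eq_one, one_mul, ← b.repr_apply_apply] at h
    rw [← h, mul_comm]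
  have h3 := Real.sin_sq_add_cos_sq (InnerProductGeometry.angle (b 0) z)
  rw [← h2] at h1
  linear_combination (‖z‖ ^ 2) * (-h3) - h1

theorem measurableSet_angle_le (x : Sph) (θ : ℝ) :
    MeasurableSet {y : Sph | InnerProductGeometry.angle (x : EuclideanSpace ℝ (Fin 3)) y ≤ θ} := by
  have h : Continuous fun y : Sph => (x, y) := continuous_const.prodMk continuous_id
  exact (isClosed_le (continuous_angle_sph.comp h) continuous_const).measurableSet

open scoped Pointwise in
/-- The cone over a cap of angular radius `θ` lies in a box with edges `2`, `2θ`, `2θ`. -/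
theorem toSphere_cap_le (x : Sph) {θ : ℝ} (hθ : 0 ≤ θ) :
    (volume : Measure (EuclideanSpace ℝ (Fin 3))).toSphere
      {y : Sph | InnerProductGeometry.angle (x : EuclideanSpace ℝ (Fin 3)) y ≤ θ} ≤
      ENNReal.ofReal (24 * θ ^ 2) := by
  obtain ⟨b, hb⟩ := exists_orthonormalBasis_head x
  rw [Measure.toSphere_apply' _ (measurableSet_angle_le x θ)]
  have hsub : (Set.Ioo (0 : ℝ) 1 • ((↑) '' {y : Sph | InnerProductGeometry.angle
      (x : EuclideanSpace ℝ (Fin 3)) y ≤ θ}) : Set (EuclideanSpace ℝ (Fin 3))) ⊆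
      {z | ∀ i, (![-1, -θ, -θ] : Fin 3 → ℝ) i ≤ b.repr z i ∧
        b.repr z i ≤ (![1, θ, θ] : Fin 3 → ℝ) i} := by
    rintro _ ⟨t, ht, _, ⟨y, hy, rfl⟩, rfl⟩
    have hang : InnerProductGeometry.angle (b 0) (t • (y : EuclideanSpace ℝ (Fin 3))) ≤ θ := by
      rw [InnerProductGeometry.angle_smul_right_of_pos _ _ ht.1, hb]; exact hy
    have hnorm : ‖t • (y : EuclideanSpace ℝ (Fin 3))‖ ≤ 1 := by
      rw [norm_smul, norm_eq_of_mem_sphere, mul_one, Real.norm_eq_abs, abs_of_pos ht.1]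
      exact ht.2.le
    show ∀ i, _ ≤ b.repr (t • (y : EuclideanSpace ℝ (Fin 3))) i ∧
      b.repr (t • (y : EuclideanSpace ℝ (Fin 3))) i ≤ _
    generalize t • (y : EuclideanSpace ℝ (Fin 3)) = z at hang hnorm
    have h0 : |b.repr z 0| ≤ 1 := by
      rw [b.repr_apply_apply]
      refine (abs_real_inner_le_norm _ _).trans ?_
      rwa [b.norm_eq_one, one_mul]
    have hsq := sq_add_sq_eq_norm_mul_sin_sq b z
    have hs : ‖z‖ * Real.sin (InnerProductGeometry.angle (b 0) z) ≤ θ :=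
      (mul_le_of_le_one_left (InnerProductGeometry.sin_angle_nonneg _ _) hnorm).trans
        ((Real.sin_le (InnerProductGeometry.angle_nonneg _ _)).trans hang)
    have hs0 : 0 ≤ ‖z‖ * Real.sin (InnerProductGeometry.angle (b 0) z) :=
      mul_nonneg (norm_nonneg _) (InnerProductGeometry.sin_angle_nonneg _ _)
    have h1 : |b.repr z 1| ≤ θ := abs_le_of_sq_le_sq (by nlinarith [sq_nonneg (b.repr z 2)]) hθ
    have h2 : |b.repr z 2| ≤ θ := abs_le_of_sq_le_sq (by nlinarith [sq_nonneg (b.repr z 1)]) hθ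
    intro i
    fin_cases i
    · exact abs_le.1 h0
    · exact abs_le.1 h1
    · exact abs_le.1 h2
  refine (mul_le_mul_right (measure_mono hsub) _).trans ?_
  rw [volume_orthonormal_box, finrank_euclideanSpace_fin, Fin.prod_univ_three,
    show ((3 : ℕ) : ℝ≥0∞) = ENNReal.ofReal 3 by simp]
  simp only [Matrix.cons_val]
  rw [← ENNReal.ofReal_mul (by norm_num), ← ENNReal.ofReal_mul (by norm_num; positivity),
    ← ENNReal.ofReal_mul (by norm_num)]
  exact ENNReal.ofReal_le_ofReal (by nlinarith)

open scoped Pointwise in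
/-- The cone over a cap of angular radius `θ` contains a box with edges `1/4`, `θ/6`, `θ/6`. -/
theorem le_toSphere_cap (x : Sph) {θ : ℝ} (hθ : 0 ≤ θ) (hθπ : θ ≤ Real.pi) :
    ENNReal.ofReal (θ ^ 2 / 48) ≤ (volume : Measure (EuclideanSpace ℝ (Fin 3))).toSphere
      {y : Sph | InnerProductGeometry.angle (x : EuclideanSpace ℝ (Fin 3)) y ≤ θ} := by
  obtain ⟨b, hb⟩ := exists_orthonormalBasis_head x
  rw [Measure.toSphere_apply' _ (measurableSet_angle_le x θ)]
  have hsub : {z | ∀ i, (![1/4, -(θ/12), -(θ/12)] : Fin 3 → ℝ) i ≤ b.repr z i ∧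
        b.repr z i ≤ (![1/2, θ/12, θ/12] : Fin 3 → ℝ) i} ⊆
      (Set.Ioo (0 : ℝ) 1 • ((↑) '' {y : Sph | InnerProductGeometry.angle
      (x : EuclideanSpace ℝ (Fin 3)) y ≤ θ}) : Set (EuclideanSpace ℝ (Fin 3))) := by
    intro z hz
    have h0 := hz 0
    have h1 := hz 1
    have h2 := hz 2
    simp only [Matrix.cons_val] at h0 h1 h2
    have hsq := sq_add_sq_eq_norm_mul_sin_sq b z
    have hn : ‖z‖ ^ 2 = b.repr z 0 ^ 2 + b.repr z 1 ^ 2 + b.repr z 2 ^ 2 := by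
      rw [← b.repr.norm_map z, EuclideanSpace.norm_sq_eq, Fin.sum_univ_three]
      simp
    have hπ := Real.pi_lt_d2
    have hπ0 := Real.pi_pos
    have hq1 : b.repr z 1 ^ 2 ≤ (θ / 12) ^ 2 := sq_le_sq' h1.1 h1.2
    have hq2 : b.repr z 2 ^ 2 ≤ (θ / 12) ^ 2 := sq_le_sq' h2.1 h2.2
    have hlt : ‖z‖ < 1 := by
      have : ‖z‖ ^ 2 < 1 := by nlinarith
      nlinarith [norm_nonneg z]
    have hgt : 1 / 4 ≤ ‖z‖ := by
      refine abs_le_of_sq_le_sq' (?_ : (1 / 4 : ℝ) ^ 2 ≤ ‖z‖ ^ 2) (norm_nonneg z) |>.2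
      nlinarith [sq_nonneg (b.repr z 1), sq_nonneg (b.repr z 2)]
    set A := InnerProductGeometry.angle (b 0) z with hA
    have hA2 : A ≤ Real.pi / 2 := by
      refine Real.arccos_le_pi_div_two.2 (div_nonneg ?_ (by positivity))
      rw [← b.repr_apply_apply]
      linarith
    have hA0 : 0 ≤ A := InnerProductGeometry.angle_nonneg _ _
    have hsin := Real.mul_le_sin hA0 hA2
    have hsin2 : A / 2 ≤ Real.sin A := by
      refine le_trans ?_ hsin
      rw [div_mul_eq_mul_div, div_le_div_iff₀ (by norm_num) hπ0]
      nlinarith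
    have hAle : A ≤ θ := by
      have h8 : 1 / 4 * (A / 2) ≤ ‖z‖ * Real.sin A :=
        mul_le_mul hgt hsin2 (by positivity) (norm_nonneg _)
      refine abs_le_of_sq_le_sq' (?_ : A ^ 2 ≤ θ ^ 2) hθ |>.2
      have := pow_le_pow_left₀ (by positivity) h8 2
      nlinarith
    have hz0 : 0 < ‖z‖ := by linarith
    refine ⟨‖z‖, ⟨hz0, hlt⟩, ‖z‖⁻¹ • z, ⟨⟨‖z‖⁻¹ • z, ?_⟩, ?_, rfl⟩, ?_⟩
    · simp [norm_smul, hz0.ne']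
    · show InnerProductGeometry.angle _ (‖z‖⁻¹ • z) ≤ θ
      rw [InnerProductGeometry.angle_smul_right_of_pos _ _ (inv_pos.2 hz0), ← hb]
      exact hAle
    · show ‖z‖ • ‖z‖⁻¹ • z = z
      rw [smul_smul, mul_inv_cancel₀ hz0.ne', one_smul]
  refine le_trans ?_ (mul_le_mul_right (measure_mono hsub) _)
  rw [volume_orthonormal_box, finrank_euclideanSpace_fin, Fin.prod_univ_three,
    show ((3 : ℕ) : ℝ≥0∞) = ENNReal.ofReal 3 by simp]
  simp only [Matrix.cons_val]
  rw [← ENNReal.ofReal_mul (by norm_num), ← ENNReal.ofReal_mul (by norm_num; positivity),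
    ← ENNReal.ofReal_mul (by norm_num)]
  exact ENNReal.ofReal_le_ofReal (by nlinarith)

/-- Multiplying the radius by `R ≥ 1` multiplies the area of a disk by at most `1152 R ^ 2`. -/
theorem surfArea_disk_mul_le (n : ℕ) (x : Sph) {r R : ℝ} (hr : 0 ≤ r) (hR : 1 ≤ R) :
    surfArea n (disk n x (R * r)) ≤ ENNReal.ofReal (1152 * R ^ 2) * surfArea n (disk n x r) := by
  have hR2 : (1 : ℝ) ≤ R ^ 2 := one_le_pow₀ hR
  have hRr : r ≤ R * r := le_mul_of_one_le_left hr hR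
  have hcoef : (1 : ℝ≥0∞) ≤ ENNReal.ofReal (1152 * R ^ 2) := by
    rw [ENNReal.one_le_ofReal]; linarith
  set s := Real.sqrt ((n : ℝ) / (4 * Real.pi)) with hs
  rcases (Real.sqrt_nonneg ((n : ℝ) / (4 * Real.pi))).eq_or_lt with h0 | hpos
  · have : disk n x (R * r) ⊆ disk n x r := by
      intro y _
      simp only [disk, surfDist, Set.mem_ofPred_eq, ← h0, zero_mul, hr]
    exact (measure_mono this).trans (le_mul_of_one_le_left zero_le hcoef)
  have hdisk : ∀ t, disk n x t =
      {y : Sph | InnerProductGeometry.angle (x : EuclideanSpace ℝ (Fin 3)) y ≤ t / s} := by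
    intro t
    ext y
    simp only [disk, surfDist, Set.mem_ofPred_eq]
    rw [le_div_iff₀ hpos, mul_comm]
  rcases le_total (r / s) Real.pi with hle | hge
  · simp only [surfArea, Measure.smul_apply, smul_eq_mul]
    rw [hdisk, hdisk, mul_left_comm]
    gcongr
    refine (toSphere_cap_le x (by positivity)).trans ?_
    refine le_trans ?_ (mul_le_mul_right (le_toSphere_cap x (by positivity) hle) _)
    rw [← ENNReal.ofReal_mul (by positivity)]
    refine ENNReal.ofReal_le_ofReal (le_of_eq ?_)
    field_simp
    ring
  · have : disk n x (R * r) ⊆ disk n x r := by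
      intro y _
      rw [hdisk]
      exact (InnerProductGeometry.angle_le_pi _ _).trans hge
    exact (measure_mono this).trans (le_mul_of_one_le_left zero_le hcoef)

theorem surfArea_univ (n : ℕ) : surfArea n Set.univ = n := by
  rw [surfArea, Measure.smul_apply, smul_eq_mul, Measure.toSphere_apply_univ,
    finrank_euclideanSpace_fin, EuclideanSpace.volume_ball_fin_three,
    show ((3 : ℕ) : ℝ≥0∞) = ENNReal.ofReal 3 by simp, ENNReal.ofReal_one, one_pow, one_mul,
    ← ENNReal.ofReal_mul (by norm_num), ← ENNReal.ofReal_mul (by positivity)]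
  rw [show (n : ℝ) / (4 * Real.pi) * (3 * (Real.pi * 4 / 3)) = n by field_simp]
  exact ENNReal.ofReal_natCast n

theorem uniformSph_apply {n : ℕ} (hn : n ≠ 0) (s : Set Sph) :
    uniformSph s = surfArea n s / n := by
  have hu := surfArea_univ n
  rw [surfArea, Measure.smul_apply, smul_eq_mul] at hu
  rw [uniformSph, ProbabilityTheory.cond_apply MeasurableSet.univ, Set.univ_inter, ← hu, surfArea,
    Measure.smul_apply, smul_eq_mul, ENNReal.mul_div_mul_left, ENNReal.div_eq_inv_mul]
  · have : (0 : ℝ) < n := by positivity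
    exact (ENNReal.ofReal_pos.2 (by positivity)).ne'
  · exact ENNReal.ofReal_ne_top

instance : IsProbabilityMeasure uniformSph :=
  ⟨by rw [uniformSph_apply one_ne_zero, surfArea_univ]; simp⟩

/-! ### Packing of Voronoi cells -/

open scoped Pointwise in
/-- The points equidistant from two distinct points form a great circle, of area zero. -/
theorem surfArea_bisector_eq_zero {n : ℕ} (hn : n ≠ 0) {p q : Sph} (hpq : p ≠ q) :
    surfArea n {x | surfDist n x p = surfDist n x q} = 0 := by
  have hpos : 0 < Real.sqrt ((n : ℝ) / (4 * Real.pi)) := by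
    have : (0 : ℝ) < n := by positivity
    positivity
  set w : EuclideanSpace ℝ (Fin 3) := (p : EuclideanSpace ℝ (Fin 3)) - q with hw
  have hw0 : w ≠ 0 := sub_ne_zero.2 fun h => hpq (Subtype.ext h)
  have hset : {x | surfDist n x p = surfDist n x q} ⊆
      {x : Sph | (x : EuclideanSpace ℝ (Fin 3)) ∈ (ℝ ∙ w)ᗮ} := by
    intro x hx
    have h1 := mul_left_cancel₀ hpos.ne' hx
    have h2 := congrArg Real.cos h1
    rw [InnerProductGeometry.cos_angle, InnerProductGeometry.cos_angle] at h2
    simp only [norm_eq_of_mem_sphere, mul_one, div_one] at h2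
    rw [Set.mem_ofPred_eq, Submodule.mem_orthogonal_singleton_iff_inner_left, hw, inner_sub_right,
      h2, sub_self]
  have hmeas : MeasurableSet {x : Sph | (x : EuclideanSpace ℝ (Fin 3)) ∈ (ℝ ∙ w)ᗮ} :=
    ((Submodule.isClosed_orthogonal (ℝ ∙ w)).preimage continuous_subtype_val).measurableSet
  refine measure_mono_null hset ?_
  rw [surfArea, Measure.smul_apply, Measure.toSphere_apply' _ hmeas]
  have hnull : volume (((ℝ ∙ w)ᗮ : Submodule ℝ (EuclideanSpace ℝ (Fin 3))) :
      Set (EuclideanSpace ℝ (Fin 3))) = 0 := by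
    apply Measure.addHaar_submodule
    intro htop
    have : w ∈ (ℝ ∙ w)ᗮ := by rw [htop]; trivial
    rw [Submodule.mem_orthogonal_singleton_iff_inner_left] at this
    exact hw0 (inner_self_eq_zero.1 this)
  rw [measure_mono_null _ hnull]
  · simp
  · rintro _ ⟨t, _, _, ⟨y, hy, rfl⟩, rfl⟩
    exact Submodule.smul_mem _ t hy

theorem surfArea_voronoiCell_inter {n : ℕ} (hn : n ≠ 0) {m : ℕ} {p : Fin m → Sph}
    (hp : Function.Injective p) {a b : Fin m} (hab : a ≠ b) :
    surfArea n (voronoiCell n p a ∩ voronoiCell n p b) = 0 :=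
  measure_mono_null (fun _ hx => le_antisymm (hx.1 b) (hx.2 a))
    (surfArea_bisector_eq_zero hn (hp.ne hab))

section Tessellation

variable {n m : ℕ} {A ρ : ℝ} {p : Fin m → Sph}

theorem le_surfArea_voronoiCell (hρ : IsDiskRadius n A ρ) (hp : IsTessellation n ρ p)
    (a : Fin m) : ENNReal.ofReal A ≤ surfArea n (voronoiCell n p a) := by
  obtain ⟨x, hx⟩ := (hp.2 a).1
  rw [← hρ.2 x]
  exact measure_mono hx

/-- Cells overlap in null sets only, so the cells inside a set number at most its area
divided by that of the inscribed disks. -/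
theorem card_mul_le_surfArea (hn : n ≠ 0) (hρ : IsDiskRadius n A ρ) (hp : IsTessellation n ρ p)
    (F : Finset (Fin m)) {s : Set Sph} (hF : ∀ a ∈ F, voronoiCell n p a ⊆ s) :
    F.card * ENNReal.ofReal A ≤ surfArea n s := by
  calc F.card * ENNReal.ofReal A = ∑ _a ∈ F, ENNReal.ofReal A := by simp
    _ ≤ ∑ a ∈ F, surfArea n (voronoiCell n p a) :=
        Finset.sum_le_sum fun a _ => le_surfArea_voronoiCell hρ hp a
    _ = surfArea n (⋃ a ∈ F, voronoiCell n p a) := by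
        rw [measure_biUnion_finset₀]
        · intro a _ b _ hab
          exact surfArea_voronoiCell_inter hn hp.1 hab
        · exact fun a _ => (isClosed_voronoiCell n p a).measurableSet.nullMeasurableSet
    _ ≤ surfArea n s := measure_mono (Set.iUnion₂_subset hF)

theorem card_cells_mul_le (hn : n ≠ 0) (hρ : IsDiskRadius n A ρ)
    (hp : IsTessellation n ρ p) : m * A ≤ n := by
  have h := card_mul_le_surfArea hn hρ hp Finset.univ (s := Set.univ) fun _ _ => Set.subset_univ _
  rw [surfArea_univ, Finset.card_fin, ← ENNReal.ofReal_natCast, ← ENNReal.ofReal_natCast n,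
    ← ENNReal.ofReal_mul (by positivity), ENNReal.ofReal_le_ofReal_iff (by positivity)] at h
  exact h

/-- A bound on the number of cells contained in a disk of radius `5ρ`. -/
theorem card_cells_subset_disk_le (hn : n ≠ 0) (hA : 0 < A) (hρ : IsDiskRadius n A ρ)
    (hp : IsTessellation n ρ p) (F : Finset (Fin m)) (x : Sph)
    (hF : ∀ a ∈ F, voronoiCell n p a ⊆ disk n x (5 * ρ)) : F.card ≤ 28800 := by
  have h := (card_mul_le_surfArea hn hρ hp F hF).trans
    (surfArea_disk_mul_le n x hρ.1 (R := 5) (by norm_num))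
  rw [hρ.2 x, ← ENNReal.ofReal_natCast, ENNReal.mul_le_mul_iff_left
    (ENNReal.ofReal_pos.2 hA).ne' ENNReal.ofReal_ne_top,
    ENNReal.ofReal_le_ofReal_iff (by norm_num)] at h
  have h' : (F.card : ℝ) ≤ (28800 : ℕ) := by norm_num at h ⊢; exact h
  exact_mod_cast h'

theorem surfDist_le_of_mem_voronoiCell (hp : IsTessellation n ρ p) {a : Fin m} {x y : Sph}
    (hx : x ∈ voronoiCell n p a) (hy : y ∈ voronoiCell n p a) : surfDist n x y ≤ 4 * ρ := by
  obtain ⟨c, hc⟩ := (hp.2 a).2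
  have h1 : surfDist n c x ≤ 2 * ρ := hc hx
  have h2 : surfDist n c y ≤ 2 * ρ := hc hy
  have h3 := surfDist_triangle n x c y
  rw [surfDist_comm n x c] at h3
  linarith

theorem diskRadius_pos (hn : n ≠ 0) (hA : 0 < A) (hρ : IsDiskRadius n A ρ) : 0 < ρ := by
  refine hρ.1.lt_of_ne' fun h0 => ?_
  obtain ⟨x⟩ : Nonempty Sph := nonempty_of_isProbabilityMeasure uniformSph
  have hs : 0 < Real.sqrt ((n : ℝ) / (4 * Real.pi)) := by
    have : (0 : ℝ) < n := by positivity
    positivity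
  have hd : disk n x ρ ⊆
      {y : Sph | InnerProductGeometry.angle (x : EuclideanSpace ℝ (Fin 3)) y ≤ 0} := by
    intro y hy
    have hy' : Real.sqrt ((n : ℝ) / (4 * Real.pi)) *
      InnerProductGeometry.angle (x : EuclideanSpace ℝ (Fin 3)) y ≤ ρ := hy
    rw [h0] at hy'
    exact nonpos_of_mul_nonpos_right hy' hs
  have h := hρ.2 x
  have hcap := toSphere_cap_le x (θ := 0) le_rfl
  simp only [ne_eq, OfNat.ofNat_ne_zero, not_false_eq_true, zero_pow, mul_zero,
    ENNReal.ofReal_zero, nonpos_iff_eq_zero] at hcap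
  rw [surfArea, Measure.smul_apply, measure_mono_null hd hcap, smul_zero] at h
  exact (ENNReal.ofReal_pos.2 hA).ne h

end Tessellation

/-! ### Hops along a chain of distinct cells -/

/-- Among `hopWindow` consecutive hops through distinct cells there is a long one: it exceeds the
packing bound of `card_cells_subset_disk_le`. -/
def hopWindow : ℕ := 28801

/-- Among `blockLength K` consecutive hops there are `K + 1` long ones, hence two long ones whose
transmitting cells share one of the `K` colours. -/
def blockLength (K : ℕ) : ℕ := hopWindow * (K + 1)

theorem blockLength_pos (K : ℕ) : 0 < blockLength K := by
  unfold blockLength hopWindow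
  positivity

theorem surfDist_chain_le {n : ℕ} (x : ℕ → Sph) {k : ℕ} {δ : ℝ} (j : ℕ)
    (h : ∀ l, k ≤ l → l < k + j → surfDist n (x l) (x (l + 1)) ≤ δ) :
    surfDist n (x k) (x (k + j)) ≤ j * δ := by
  induction j with
  | zero => simp [surfDist_self]
  | succ j ih =>
    have h1 := ih fun l hl hl' => h l hl (by omega)
    have h2 := h (k + j) (by omega) (by omega)
    have h3 := surfDist_triangle n (x k) (x (k + j)) (x (k + j + 1))
    rw [← add_assoc]
    push_cast
    linarith

section Chain

variable {n m K H : ℕ} {A ρ : ℝ} {p : Fin m → Sph} {x : ℕ → Sph} {c : ℕ → Fin m}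

theorem surfDist_hop_le (hp : IsTessellation n ρ p) (hx : ∀ k, x k ∈ voronoiCell n p (c k)) {k : ℕ}
    (hz : (voronoiCell n p (c k) ∩ voronoiCell n p (c (k + 1))).Nonempty) :
    surfDist n (x k) (x (k + 1)) ≤ 8 * ρ := by
  obtain ⟨z, hz1, hz2⟩ := hz
  have h1 := surfDist_le_of_mem_voronoiCell hp (hx k) hz1
  have h2 := surfDist_le_of_mem_voronoiCell hp hz2 (hx (k + 1))
  have h3 := surfDist_triangle n (x k) z (x (k + 1))
  linarith

/-- If all hops of a window were short, all its cells would lie in a disk of radius `5ρ` about the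
first relay, which has no room for so many cells. -/
theorem exists_long_hop (hn : n ≠ 0) (hA : 0 < A) (hρ : IsDiskRadius n A ρ)
    (hp : IsTessellation n ρ p) (hx : ∀ k, x k ∈ voronoiCell n p (c k))
    (hc : ∀ k < H, ∀ l < H, c k = c l → k = l) {k : ℕ} (hk : k + hopWindow ≤ H) :
    ∃ l, k ≤ l ∧ l < k + hopWindow ∧ ρ / hopWindow < surfDist n (x l) (x (l + 1)) := by
  by_contra! hcon
  have hW : (0 : ℝ) < hopWindow := by norm_num [hopWindow]
  have hinj : Set.InjOn (fun j => c (k + j)) (Finset.range hopWindow : Set ℕ) := by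
    intro a ha b hb hab
    simp only [Finset.coe_range, Set.mem_Iio] at ha hb
    have := hc (k + a) (by omega) (k + b) (by omega) hab
    omega
  have hcard := card_cells_subset_disk_le hn hA hρ hp
    ((Finset.range hopWindow).image fun j => c (k + j)) (x k) (by
      intro a ha y hy
      obtain ⟨j, hj, rfl⟩ := Finset.mem_image.1 ha
      rw [Finset.mem_range] at hj
      have h1 := surfDist_chain_le x (k := k) (δ := ρ / hopWindow) j
        fun l hl hl' => hcon l hl (by omega)
      have h2 := surfDist_le_of_mem_voronoiCell hp (hx (k + j)) hy
      have h3 := surfDist_triangle n (x k) (x (k + j)) y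
      have h4 : (j : ℝ) * (ρ / hopWindow) ≤ ρ := by
        rw [mul_div_assoc', div_le_iff₀ hW, mul_comm]
        exact mul_le_mul_of_nonneg_left (by exact_mod_cast hj.le) hρ.1
      show surfDist n (x k) y ≤ 5 * ρ
      linarith)
  rw [Finset.card_image_of_injOn hinj, Finset.card_range] at hcard
  norm_num [hopWindow] at hcard

theorem exists_long_hop_same_color (hn : n ≠ 0) (hA : 0 < A) (hρ : IsDiskRadius n A ρ)
    (hp : IsTessellation n ρ p) (hx : ∀ k, x k ∈ voronoiCell n p (c k))
    (hc : ∀ k < H, ∀ l < H, c k = c l → k = l) (color : Fin m → Fin K) {k : ℕ}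
    (hk : k + blockLength K ≤ H) :
    ∃ l l', l ≠ l' ∧ (k ≤ l ∧ l < k + blockLength K) ∧ (k ≤ l' ∧ l' < k + blockLength K) ∧
      color (c l) = color (c l') ∧ ρ / hopWindow < surfDist n (x l) (x (l + 1)) := by
  have hwin : ∀ j : Fin (K + 1), k + hopWindow * j + hopWindow ≤ k + blockLength K := by
    intro j
    have : hopWindow * ((j : ℕ) + 1) ≤ hopWindow * (K + 1) :=
      Nat.mul_le_mul_left _ (by omega)
    rw [blockLength]
    rw [mul_add, mul_one] at this
    omega
  choose f hf1 hf2 hf3 using fun j : Fin (K + 1) =>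
    exists_long_hop hn hA hρ hp hx hc ((hwin j).trans hk)
  obtain ⟨i, j, hij, hcol⟩ := Fintype.exists_ne_map_eq_of_card_lt
    (fun j => color (c (f j))) (by simp)
  refine ⟨f i, f j, fun hfe => hij ?_, ⟨?_, ?_⟩, ⟨?_, ?_⟩, hcol, hf3 i⟩
  · -- windows with different indices are disjoint
    have hW : 0 < hopWindow := by norm_num [hopWindow]
    have h1 := hf1 i
    have h2 := hf2 i
    have h3 := hf1 j
    have h4 := hf2 j
    rw [hfe] at h1 h2
    have h5 : hopWindow * (i : ℕ) < hopWindow * ((j : ℕ) + 1) := by rw [mul_add, mul_one]; omega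
    have h6 : hopWindow * (j : ℕ) < hopWindow * ((i : ℕ) + 1) := by rw [mul_add, mul_one]; omega
    have h7 := lt_of_mul_lt_mul_left h5 (Nat.zero_le _)
    have h8 := lt_of_mul_lt_mul_left h6 (Nat.zero_le _)
    exact Fin.ext (by omega)
  · have := hf1 i; omega
  · have := hf2 i; have := hwin i; omega
  · have := hf1 j; omega
  · have := hf2 j; have := hwin j; omega

end Chain

/-! ### Interference on a long hop -/

/-- An interferer at distance at most `R` keeps the SINR of a hop of length at least `r` below
`(R / r) ^ α`. -/
theorem sinr_le {n : ℕ} {P α r R : ℝ} (hP : 0 < P) (hα : 0 ≤ α) (hr : 0 < r) (hR : 0 < R)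
    {X : Fin n → Sph} {T : Finset (Fin n)} {i j k : Fin n} (hk : k ∈ T) (hki : k ≠ i)
    (hij : r ≤ surfDist n (X i) (X j)) (hkj : surfDist n (X k) (X j) ≤ R) :
    sinr P α X T i j ≤ ENNReal.ofReal ((R / r) ^ α) := by
  have h1 : rxPower n P α (X i) (X j) ≤ ENNReal.ofReal (P / r ^ α) := by
    rw [ENNReal.ofReal_div_of_pos (by positivity), ← ENNReal.ofReal_rpow_of_pos hr]
    exact ENNReal.div_le_div_left
      (ENNReal.rpow_le_rpow (ENNReal.ofReal_le_ofReal hij) hα) _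
  have h2 : ENNReal.ofReal (P / R ^ α) ≤ rxPower n P α (X k) (X j) := by
    rw [ENNReal.ofReal_div_of_pos (by positivity), ← ENNReal.ofReal_rpow_of_pos hR]
    exact ENNReal.div_le_div_left
      (ENNReal.rpow_le_rpow (ENNReal.ofReal_le_ofReal hkj) hα) _
  have h3 : rxPower n P α (X k) (X j) ≤ ∑ k ∈ T.erase i, rxPower n P α (X k) (X j) :=
    Finset.single_le_sum (f := fun k => rxPower n P α (X k) (X j)) (fun _ _ => zero_le)
      (Finset.mem_erase.2 ⟨hki, hk⟩)
  refine ENNReal.div_le_of_le_mul (h1.trans (le_trans ?_ (mul_le_mul_right (h2.trans h3) _)))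
  rw [← ENNReal.ofReal_mul (by positivity)]
  refine ENNReal.ofReal_le_ofReal (le_of_eq ?_)
  rw [Real.div_rpow hR.le hr.le]
  have := (Real.rpow_pos_of_pos hR α).ne'
  have := (Real.rpow_pos_of_pos hr α).ne'
  field_simp

section LinkSuccess

variable {φ : ℝ → ℝ}

theorem linkSuccess_nonneg (hφ : ∀ x, 0 ≤ x → 0 ≤ φ x) (s : ℝ≥0∞) : 0 ≤ linkSuccess φ s := by
  unfold linkSuccess
  split_ifs
  · exact zero_le_one
  · exact hφ _ ENNReal.toReal_nonneg

theorem linkSuccess_le_one (hφ : ∀ x, 0 ≤ x → φ x < 1) (s : ℝ≥0∞) : linkSuccess φ s ≤ 1 := by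
  unfold linkSuccess
  split_ifs
  · exact le_rfl
  · exact (hφ _ ENNReal.toReal_nonneg).le

theorem linkSuccess_le (hφ : MonotoneOn φ (Set.Ici 0)) {s : ℝ≥0∞} {B : ℝ} (hB : 0 ≤ B)
    (hs : s ≤ ENNReal.ofReal B) : linkSuccess φ s ≤ φ B := by
  rw [linkSuccess, if_neg (ne_top_of_le_ne_top ENNReal.ofReal_ne_top hs)]
  exact hφ ENNReal.toReal_nonneg hB (ENNReal.toReal_le_of_le_ofReal hB hs)

theorem packetSuccess_nonneg {n m K : ℕ} (hφ : ∀ x, 0 ≤ x → 0 ≤ φ x) (S : Plan n m) (P α : ℝ)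
    (color : Fin m → Fin K) (X : Fin n → Sph) (i : Fin n) (s : ℕ) :
    0 ≤ S.packetSuccess φ P α color X i s :=
  Finset.prod_nonneg fun _ _ => linkSuccess_nonneg hφ _

theorem packetSuccess_le_one {n m K : ℕ} (hφ0 : ∀ x, 0 ≤ x → 0 ≤ φ x)
    (hφ : ∀ x, 0 ≤ x → φ x < 1) (S : Plan n m) (P α : ℝ)
    (color : Fin m → Fin K) (X : Fin n → Sph) (i : Fin n) (s : ℕ) :
    S.packetSuccess φ P α color X i s ≤ 1 :=
  Finset.prod_le_one (fun _ _ => linkSuccess_nonneg hφ0 _) fun _ _ => linkSuccess_le_one hφ _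

end LinkSuccess

/-- A product of numbers in `[0, 1]`, each block of `M` of which contains one that is at most
`β`. -/
theorem prod_range_le_pow {a : ℕ → ℝ} {β : ℝ} (h0 : ∀ k, 0 ≤ a k) (h1 : ∀ k, a k ≤ 1)
    (M H : ℕ) (h : ∀ k, k + M ≤ H → ∃ l, k ≤ l ∧ l < k + M ∧ a l ≤ β) (b : ℕ) (hb : M * b ≤ H) :
    ∏ k ∈ Finset.range H, a k ≤ β ^ b := by
  have hsplit : ∀ s t : ℕ, s ≤ t → ∏ k ∈ Finset.range t, a k ≤ ∏ k ∈ Finset.range s, a k :=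
    fun s t hst => Finset.prod_le_prod_of_subset_of_le_one (Finset.range_subset_range.2 hst)
      (fun k _ => h0 k) fun k _ _ => h1 k
  refine (hsplit _ _ hb).trans ?_
  clear hsplit
  induction b with
  | zero => simp
  | succ b ih =>
    rw [mul_add, mul_one] at hb
    obtain ⟨l, hl1, hl2, hl3⟩ := h (M * b) hb
    rw [mul_add, mul_one, Finset.prod_range_add, pow_succ]
    refine mul_le_mul (ih (by omega)) ?_ (Finset.prod_nonneg fun k _ => h0 _)
      (le_trans (Finset.prod_nonneg fun k _ => h0 _) (ih (by omega)))
    refine le_trans ?_ hl3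
    rw [← Finset.mul_prod_erase _ _ (Finset.mem_range.2 (by omega : l - M * b < M)),
      show M * b + (l - M * b) = l by omega]
    exact mul_le_of_le_one_right (h0 l)
      (Finset.prod_le_one (fun k _ => h0 _) fun k _ => h1 _)

/-- The bound on the SINR of a long hop with a same-coloured cell in its block. -/
noncomputable def sinrBound (K : ℕ) (α : ℝ) : ℝ := (8 * (blockLength K + 2) * hopWindow : ℝ) ^ α

theorem sinrBound_nonneg (K : ℕ) (α : ℝ) : 0 ≤ sinrBound K α := by
  unfold sinrBound
  positivity

section Obeys

variable {n m K : ℕ} {A ρ α P : ℝ} {p : Fin m → Sph} {color : Fin m → Fin K} {φ : ℝ → ℝ}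
  {ω : Deployment n} {S : Plan n m}

theorem surfDist_source_dest_le (hp : IsTessellation n ρ p) (hS : S.Obeys p color ω)
    {i : Fin n} {s : ℕ} (hs : s ∈ S.inj i) :
    surfDist n (ω.1 i) (ω.1 (ω.2 i)) ≤ S.hops i s * (8 * ρ) := by
  obtain ⟨h0, hH, -, -, z, hz, -⟩ := hS.route i s hs
  have h := surfDist_chain_le (n := n) (fun k => ω.1 (S.relay i s k)) (k := 0) (δ := 8 * ρ)
    (S.hops i s) fun l _ hl => surfDist_hop_le (c := fun k => S.home (S.relay i s k)) hp
      (fun k => hS.home_mem _) ⟨z l, (hz l (by omega)).1⟩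
  simpa only [zero_add, h0, hH] using h

/-- Every block of hops contains one whose success probability is bounded away from one. -/
theorem exists_lossy_hop (hn : n ≠ 0) (hA : 0 < A) (hρ : IsDiskRadius n A ρ)
    (hp : IsTessellation n ρ p) (hP : 0 < P) (hα : 0 ≤ α) (hφ : MonotoneOn φ (Set.Ici 0))
    (hS : S.Obeys p color ω) {i : Fin n} {s : ℕ} (hs : s ∈ S.inj i) (k : ℕ)
    (hk : k + blockLength K ≤ S.hops i s) :
    ∃ l, k ≤ l ∧ l < k + blockLength K ∧
      linkSuccess φ (sinr P α ω.1 (S.transmitters color (S.slot i s l))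
        (S.relay i s l) (S.relay i s (l + 1))) ≤ φ (sinrBound K α) := by
  obtain ⟨-, -, hc, -, z, hz, -⟩ := hS.route i s hs
  have hρ0 := diskRadius_pos hn hA hρ
  have hx : ∀ k, ω.1 (S.relay i s k) ∈ voronoiCell n p (S.home (S.relay i s k)) :=
    fun k => hS.home_mem _
  have hhop : ∀ l < S.hops i s,
      surfDist n (ω.1 (S.relay i s l)) (ω.1 (S.relay i s (l + 1))) ≤ 8 * ρ := fun l hl =>
    surfDist_hop_le (x := fun k => ω.1 (S.relay i s k)) (c := fun k => S.home (S.relay i s k))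
      hp hx ⟨z l, (hz l hl).1⟩
  obtain ⟨l, l', hne, hl, hl', hcol, hlong⟩ := exists_long_hop_same_color
    (x := fun k => ω.1 (S.relay i s k)) (c := fun k => S.home (S.relay i s k))
    hn hA hρ hp hx hc color hk
  have hclose : ∀ a b, k ≤ a → a ≤ b → b < k + blockLength K →
      surfDist n (ω.1 (S.relay i s a)) (ω.1 (S.relay i s b)) ≤ blockLength K * (8 * ρ) := by
    intro a b ha hab hb
    have h := surfDist_chain_le (n := n) (fun k => ω.1 (S.relay i s k)) (k := a) (δ := 8 * ρ)
      (b - a) fun q _ hq => hhop q (by omega)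
    rw [Nat.add_sub_cancel' hab] at h
    refine h.trans (mul_le_mul_of_nonneg_right ?_ (by positivity))
    exact_mod_cast (by omega : b - a ≤ blockLength K)
  have hclose' : surfDist n (ω.1 (S.relay i s l')) (ω.1 (S.relay i s l)) ≤
      blockLength K * (8 * ρ) := by
    rcases le_total l l' with h | h
    · rw [surfDist_comm]
      exact hclose l l' hl.1 h hl'.2
    · exact hclose l' l hl'.1 h hl.2
  -- the interferer is the node that transmits in the cell of the `l'`-th relay
  set t := S.slot i s l
  set a := S.home (S.relay i s l')
  have hserved : (color a : ℕ) = t % K := by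
    rw [← hcol]
    exact hS.slot_color i s hs l (by omega)
  have hhome : S.home (S.tx t a) = a := hS.tx_home t a hserved
  refine ⟨l, hl.1, hl.2, linkSuccess_le hφ (sinrBound_nonneg K α) ?_⟩
  have hW : (0 : ℝ) < hopWindow := by norm_num [hopWindow]
  have hratio : 8 * (blockLength K + 2) * ρ / (ρ / hopWindow) =
      (8 * (blockLength K + 2) * hopWindow : ℝ) := by
    field_simp
  rw [sinrBound, ← hratio]
  refine sinr_le hP hα (by positivity) (by positivity) (k := S.tx t a) ?_ ?_ hlong.le ?_
  · exact Finset.mem_image_of_mem _ (Finset.mem_filter.2 ⟨Finset.mem_univ _, hserved⟩)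
  · intro heq
    rw [heq] at hhome
    exact hne (hc l (by omega) l' (by omega) hhome)
  · have h1 := surfDist_le_of_mem_voronoiCell hp (hhome ▸ hS.home_mem (S.tx t a)) (hx l')
    have h2 := hhop l (by omega)
    have h3 := surfDist_triangle n (ω.1 (S.tx t a)) (ω.1 (S.relay i s l'))
      (ω.1 (S.relay i s (l + 1)))
    have h4 := surfDist_triangle n (ω.1 (S.relay i s l')) (ω.1 (S.relay i s l))
      (ω.1 (S.relay i s (l + 1)))
    linarith

theorem packetSuccess_le_pow (hn : n ≠ 0) (hA : 0 < A) (hρ : IsDiskRadius n A ρ)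
    (hp : IsTessellation n ρ p) (hP : 0 < P) (hα : 0 ≤ α) (hφ : MonotoneOn φ (Set.Ici 0))
    (hφ0 : ∀ x, 0 ≤ x → 0 ≤ φ x) (hφ1 : ∀ x, 0 ≤ x → φ x < 1)
    (hS : S.Obeys p color ω) {i : Fin n} {s : ℕ} (hs : s ∈ S.inj i) (b : ℕ)
    (hb : blockLength K * b ≤ S.hops i s) :
    S.packetSuccess φ P α color ω.1 i s ≤ φ (sinrBound K α) ^ b :=
  prod_range_le_pow
    (a := fun k => linkSuccess φ (sinr P α ω.1 (S.transmitters color (S.slot i s k))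
      (S.relay i s k) (S.relay i s (k + 1))))
    (fun _ => linkSuccess_nonneg hφ0 _) (fun _ => linkSuccess_le_one hφ1 _)
    (blockLength K) _ (exists_lossy_hop hn hA hρ hp hP hα hφ hS hs) b hb

/-! ### Injection rate and throughput -/

/-- In every slot at most one of the nodes of a cell injects a packet. -/
theorem sum_indicator_inj_le_one (hS : S.Obeys p color ω) (hd : ∀ i, ω.2 i ≠ i)
    (a : Fin m) (s : ℕ) :
    ∑ j with S.home j = a, (S.inj j).indicator (fun _ => (1 : ℝ)) s ≤ 1 := by
  classical
  simp only [Set.indicator_apply]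
  rw [← Finset.sum_filter, Finset.sum_const, nsmul_eq_mul, mul_one, ← Nat.cast_one, Nat.cast_le,
    Finset.card_le_one]
  have hpos : ∀ j, s ∈ S.inj j → 0 < S.hops j s ∧ S.relay j s 0 = j := by
    intro j hj
    obtain ⟨h0, hH, -⟩ := hS.route j s hj
    refine ⟨Nat.pos_of_ne_zero fun h => hd j ?_, h0⟩
    rw [← hH, h, h0]
  intro j hj j' hj'
  simp only [Finset.mem_filter, Finset.mem_univ, true_and] at hj hj'
  have h1 := hpos j hj.2
  have h2 := hpos j' hj'.2
  exact (hS.single j s hj.2 0 h1.1 j' s hj'.2 0 h2.1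
    (by rw [hS.slot_zero j s hj.2, hS.slot_zero j' s hj'.2])
    (by rw [h1.2, h2.2, hj.1, hj'.1])).1

theorem card_mul_rate_le_one (hS : S.Obeys p color ω) (hd : ∀ i, ω.2 i ≠ i) (a : Fin m) :
    (Finset.univ.filter fun j => S.home j = a).card * S.rate ≤ 1 := by
  have hlim := tendsto_finsetSum (Finset.univ.filter fun j => S.home j = a)
    fun j _ => hS.inj_rate j
  rw [Finset.sum_const, nsmul_eq_mul] at hlim
  refine le_of_tendsto' hlim fun T => ?_
  rw [← Finset.sum_div, Finset.sum_comm]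
  refine div_le_one_of_le₀ ?_ (Nat.cast_nonneg T)
  calc _ ≤ ∑ _s ∈ Finset.range T, (1 : ℝ) :=
        Finset.sum_le_sum fun s _ => sum_indicator_inj_le_one hS hd a s
    _ = T := by simp

theorem rate_nonneg (hS : S.Obeys p color ω) (i : Fin n) : 0 ≤ S.rate :=
  ge_of_tendsto' (hS.inj_rate i) fun T => div_nonneg
    (Finset.sum_nonneg fun s _ => Set.indicator_nonneg (fun _ _ => zero_le_one) s)
    (Nat.cast_nonneg T)

/-- There are at most `n / A` cells, so one of them contains at least `A` of the `n` nodes, which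
share its slots. -/
theorem rate_le (hA : 0 < A) (hm : m * A ≤ n) (i : Fin n) (hS : S.Obeys p color ω)
    (hd : ∀ i, ω.2 i ≠ i) : S.rate ≤ 1 / A := by
  have hm0 : (0 : ℝ) < m := by
    exact_mod_cast Fin.pos (S.home i)
  have : Nonempty (Fin m) := ⟨S.home i⟩
  obtain ⟨a, -, ha⟩ := Finset.exists_le_card_fiber_of_nsmul_le_card_of_maps_to
    (s := (Finset.univ : Finset (Fin n))) (t := (Finset.univ : Finset (Fin m))) (f := S.home)
    (b := A) (fun _ _ => Finset.mem_univ _) Finset.univ_nonempty (by simpa using hm)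
  rw [le_div_iff₀ hA, mul_comm]
  exact (mul_le_mul_of_nonneg_right ha (rate_nonneg hS i)).trans (card_mul_rate_le_one hS hd a)

theorem isCoboundedUnder_average {f : ℕ → ℝ} (hf : ∀ s, 0 ≤ f s) :
    IsCoboundedUnder (· ≤ ·) atTop fun T : ℕ => (∑ s ∈ Finset.range T, f s) / T :=
  IsBoundedUnder.isCoboundedUnder_le
    (isBoundedUnder_of ⟨0, fun T : ℕ =>
      div_nonneg (Finset.sum_nonneg fun s _ => hf s) (Nat.cast_nonneg T)⟩)

theorem throughput_le_one (hφ0 : ∀ x, 0 ≤ x → 0 ≤ φ x) (hφ1 : ∀ x, 0 ≤ x → φ x < 1)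
    (S : Plan n m) (color : Fin m → Fin K) (X : Fin n → Sph) (i : Fin n) :
    S.throughput φ P α color X i ≤ 1 := by
  refine limsup_le_of_le (isCoboundedUnder_average fun s =>
    Set.indicator_nonneg (fun _ _ => packetSuccess_nonneg hφ0 S _ _ _ _ _ _) s)
    (Eventually.of_forall fun T => ?_)
  refine div_le_one_of_le₀ ?_ (Nat.cast_nonneg T)
  calc _ ≤ ∑ _s ∈ Finset.range T, (1 : ℝ) := Finset.sum_le_sum fun s _ =>
        Set.indicator_apply_le' (fun _ => packetSuccess_le_one hφ0 hφ1 S _ _ _ _ _ _)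
          fun _ => zero_le_one
    _ = T := by simp

theorem throughput_le_rate_mul (hφ0 : ∀ x, 0 ≤ x → 0 ≤ φ x) (hS : S.Obeys p color ω)
    {i : Fin n} {q : ℝ} (hq : ∀ s ∈ S.inj i, S.packetSuccess φ P α color ω.1 i s ≤ q) :
    S.throughput φ P α color ω.1 i ≤ S.rate * q := by
  have hlim := (hS.inj_rate i).mul_const q
  rw [← hlim.limsup_eq]
  refine limsup_le_limsup (Eventually.of_forall fun T => ?_)
    (isCoboundedUnder_average fun s =>
      Set.indicator_nonneg (fun _ _ => packetSuccess_nonneg hφ0 S _ _ _ _ _ _) s)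
    hlim.isBoundedUnder_le
  dsimp only
  rw [div_mul_eq_mul_div, Finset.sum_mul]
  refine div_le_div_of_nonneg_right (Finset.sum_le_sum fun s _ => ?_) (Nat.cast_nonneg T)
  by_cases hs : s ∈ S.inj i
  · simpa [hs] using hq s hs
  · simp [hs]

/-- If the distance to the destination exceeds the reach of `b` blocks of hops, then the packets
pass `b` lossy hops. -/
theorem throughput_le_of_lt_surfDist (hn : n ≠ 0) (hA : 0 < A) (hρ : IsDiskRadius n A ρ)
    (hp : IsTessellation n ρ p) (hP : 0 < P) (hα : 0 ≤ α) (hφ : MonotoneOn φ (Set.Ici 0))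
    (hφ0 : ∀ x, 0 ≤ x → 0 ≤ φ x) (hφ1 : ∀ x, 0 ≤ x → φ x < 1)
    (hS : S.Obeys p color ω) (hd : ∀ i, ω.2 i ≠ i) (i : Fin n) (b : ℕ)
    (hb : b = 0 ∨ 8 * blockLength K * b * ρ < surfDist n (ω.1 i) (ω.1 (ω.2 i))) :
    S.throughput φ P α color ω.1 i ≤ 1 / A * φ (sinrBound K α) ^ b := by
  have hρ0 := diskRadius_pos hn hA hρ
  refine (throughput_le_rate_mul hφ0 hS fun s hs =>
    packetSuccess_le_pow hn hA hρ hp hP hα hφ hφ0 hφ1 hS hs b ?_).trans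
    (mul_le_mul_of_nonneg_right (rate_le hA (card_cells_mul_le hn hρ hp) i hS hd)
      (pow_nonneg (hφ0 _ (sinrBound_nonneg K α)) b))
  rcases hb with rfl | hb
  · simp
  · have h := hb.trans_le (surfDist_source_dest_le hp hS hs)
    have h' : (blockLength K * b : ℝ) < S.hops i s := by
      by_contra! hcon
      nlinarith
    exact_mod_cast h'.le

end Obeys

/-! ### The random deployment -/

section Law

variable {n : ℕ}

theorem isProbabilityMeasure_uniformOn_ne (hn : 2 ≤ n) (i : Fin n) :
    IsProbabilityMeasure (ProbabilityTheory.uniformOn {j : Fin n | j ≠ i}) := by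
  have : Nontrivial (Fin n) := Fin.nontrivial_iff_two_le.2 hn
  exact ProbabilityTheory.isProbabilityMeasure_uniformOn (Set.toFinite _) (exists_ne i)

theorem ae_pi_uniformOn_ne (hn : 2 ≤ n) :
    ∀ᵐ D ∂(Measure.pi fun i : Fin n => ProbabilityTheory.uniformOn {j : Fin n | j ≠ i}),
      ∀ i, D i ≠ i := by
  have hprob := fun i => isProbabilityMeasure_uniformOn_ne hn i
  rw [ae_all_iff]
  intro i
  have h : ∀ᵐ j ∂ProbabilityTheory.uniformOn {j : Fin n | j ≠ i}, j ≠ i :=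
    ProbabilityTheory.ae_cond_mem MeasurableSet.of_discrete
  exact (Measure.quasiMeasurePreserving_eval
    (fun i : Fin n => ProbabilityTheory.uniformOn {j : Fin n | j ≠ i}) i).ae h

theorem ae_dest_ne (hn : 2 ≤ n) : ∀ᵐ ω ∂deploymentLaw n, ∀ i, ω.2 i ≠ i := by
  have hprob := fun i => isProbabilityMeasure_uniformOn_ne hn i
  exact (Measure.quasiMeasurePreserving_snd
    (μ := Measure.pi fun _ : Fin n => uniformSph)).ae (ae_pi_uniformOn_ne hn)

theorem measurableSet_surfDist_le (r : ℝ) :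
    MeasurableSet {q : Sph × Sph | surfDist n q.1 q.2 ≤ r} :=
  (isClosed_le (continuous_surfDist n) continuous_const).measurableSet

theorem measurableSet_surfDist_dest_le (i : Fin n) (r : ℝ) :
    MeasurableSet {ω : Deployment n | surfDist n (ω.1 i) (ω.1 (ω.2 i)) ≤ r} := by
  have h : {ω : Deployment n | surfDist n (ω.1 i) (ω.1 (ω.2 i)) ≤ r} =
      ⋃ j, {ω | ω.2 i = j} ∩ {ω | surfDist n (ω.1 i) (ω.1 j) ≤ r} := by
    ext ω
    simp
  rw [h]
  refine MeasurableSet.iUnion fun j => MeasurableSet.inter ?_ ?_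
  · have hm : Measurable fun ω : Deployment n => ω.2 i := by fun_prop
    exact hm (MeasurableSet.singleton j)
  · have hm : Measurable fun ω : Deployment n => (ω.1 i, ω.1 j) := by fun_prop
    exact hm (measurableSet_surfDist_le r)

/-- Two nodes are within distance `r` with at most the probability of a disk of radius `r`. -/
theorem measure_surfDist_pair_le {i j : Fin n} (hij : i ≠ j) {r : ℝ} {q : ℝ≥0∞}
    (hq : ∀ x, uniformSph (disk n x r) ≤ q) :
    (Measure.pi fun _ : Fin n => uniformSph) {X | surfDist n (X i) (X j) ≤ r} ≤ q := by
  have hind := (ProbabilityTheory.iIndepFun_pi (Ω := fun _ : Fin n => Sph)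
    (μ := fun _ => uniformSph) (X := fun _ x => x) fun _ => aemeasurable_id).indepFun hij
  have hmap := (ProbabilityTheory.indepFun_iff_map_prod_eq_prod_map_map
    (measurable_pi_apply i).aemeasurable (measurable_pi_apply j).aemeasurable).1 hind
  have he : ∀ k : Fin n, (Measure.pi fun _ : Fin n => uniformSph).map (fun X => X k) =
      uniformSph := fun k => (measurePreserving_eval (fun _ : Fin n => uniformSph) k).map_eq
  rw [he, he] at hmap
  have hpre : {X : Fin n → Sph | surfDist n (X i) (X j) ≤ r} =
      (fun X => (X i, X j)) ⁻¹' {q : Sph × Sph | surfDist n q.1 q.2 ≤ r} := rfl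
  rw [hpre, ← Measure.map_apply (by fun_prop) (measurableSet_surfDist_le r), hmap,
    Measure.prod_apply (measurableSet_surfDist_le r)]
  calc _ ≤ ∫⁻ _, q ∂uniformSph := lintegral_mono fun x => hq x
    _ = q := by simp

theorem measure_surfDist_dest_le (hn : 2 ≤ n) (i : Fin n) {r : ℝ} {q : ℝ≥0∞}
    (hq : ∀ x, uniformSph (disk n x r) ≤ q) :
    deploymentLaw n {ω | surfDist n (ω.1 i) (ω.1 (ω.2 i)) ≤ r} ≤ q := by
  have hprob := fun i => isProbabilityMeasure_uniformOn_ne hn i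
  rw [deploymentLaw, Measure.prod_apply_symm (measurableSet_surfDist_dest_le i r)]
  calc _ ≤ ∫⁻ _, q ∂(Measure.pi fun i : Fin n =>
        ProbabilityTheory.uniformOn {j : Fin n | j ≠ i}) := by
        refine lintegral_mono_ae ?_
        filter_upwards [ae_pi_uniformOn_ne hn] with D hD
        exact measure_surfDist_pair_le (hD i).symm hq
    _ = q := by simp

theorem measurableSet_exists_empty_cell {m : ℕ} (p : Fin m → Sph) :
    MeasurableSet {ω : Deployment n | ∃ a, ∀ j, ω.1 j ∉ voronoiCell n p a} := by
  have h : {ω : Deployment n | ∃ a, ∀ j, ω.1 j ∉ voronoiCell n p a} =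
      ⋃ a, ⋂ j, (fun ω => ω.1 j) ⁻¹' (voronoiCell n p a)ᶜ := by
    ext ω
    simp
  rw [h]
  refine MeasurableSet.iUnion fun a => MeasurableSet.iInter fun j => ?_
  have hm : Measurable fun ω : Deployment n => ω.1 j := by fun_prop
  exact hm (isClosed_voronoiCell n p a).measurableSet.compl

/-- Union bound over the cells: all `n` nodes miss a given cell with probability at most
`(1 - A / n) ^ n`. -/
theorem measure_exists_empty_cell_le (hn : 2 ≤ n) {m : ℕ} {A ρ : ℝ} (hA : 0 ≤ A)
    (hρ : IsDiskRadius n A ρ) {p : Fin m → Sph} (hp : IsTessellation n ρ p) :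
    deploymentLaw n {ω | ∃ a, ∀ j, ω.1 j ∉ voronoiCell n p a} ≤
      m * ENNReal.ofReal (Real.exp (-A)) := by
  have hprob := fun i => isProbabilityMeasure_uniformOn_ne hn i
  have hn0 : n ≠ 0 := by omega
  have hnpos : (0 : ℝ) < n := by positivity
  have h : {ω : Deployment n | ∃ a, ∀ j, ω.1 j ∉ voronoiCell n p a} =
      ⋃ a, (Set.univ.pi fun _ : Fin n => (voronoiCell n p a)ᶜ) ×ˢ Set.univ := by
    ext ω
    simp
  rw [h]
  refine (measure_iUnion_fintype_le _ _).trans ?_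
  calc _ ≤ ∑ _a : Fin m, ENNReal.ofReal (Real.exp (-A)) := Finset.sum_le_sum fun a _ => ?_
    _ = _ := by simp
  rw [deploymentLaw, Measure.prod_prod, Measure.pi_pi, measure_univ, mul_one, Finset.prod_const,
    Finset.card_fin, prob_compl_eq_one_sub (isClosed_voronoiCell n p a).measurableSet,
    uniformSph_apply hn0]
  have hcell := le_surfArea_voronoiCell hρ hp a
  have hAn : A ≤ n := by
    have h1 := hcell.trans (measure_mono (Set.subset_univ _))
    rw [surfArea_univ, ← ENNReal.ofReal_natCast, ENNReal.ofReal_le_ofReal_iff hnpos.le] at h1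
    exact h1
  have h1 : 1 - surfArea n (voronoiCell n p a) / n ≤ ENNReal.ofReal (1 - A / n) := by
    rw [ENNReal.ofReal_sub _ (by positivity), ENNReal.ofReal_one, ENNReal.ofReal_div_of_pos hnpos,
      ENNReal.ofReal_natCast]
    exact tsub_le_tsub_left (ENNReal.div_le_div_right hcell _) _
  refine (pow_le_pow_left₀ zero_le h1 n).trans ?_
  rw [← ENNReal.ofReal_pow (sub_nonneg.2 (div_le_one_of_le₀ hAn hnpos.le))]
  exact ENNReal.ofReal_le_ofReal (Real.one_sub_div_pow_le_exp_neg hAn)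

theorem uniformSph_disk_mul_le (hn : n ≠ 0) {A ρ R : ℝ} (hρ : IsDiskRadius n A ρ) (hR : 1 ≤ R)
    (x : Sph) : uniformSph (disk n x (R * ρ)) ≤ ENNReal.ofReal (1152 * R ^ 2 * A / n) := by
  have hnpos : (0 : ℝ) < n := by positivity
  rw [uniformSph_apply hn, ENNReal.ofReal_div_of_pos hnpos, ENNReal.ofReal_natCast,
    ENNReal.ofReal_mul (by positivity), ← hρ.2 x]
  exact ENNReal.div_le_div_right (surfArea_disk_mul_le n x hρ.1 hR) _

end Law

/-- The constant of the throughput bound: the series over the number of blocks of hops that fit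
between source and destination, plus one for deployments with an empty cell. -/
noncomputable def throughputConst (K : ℕ) (β : ℝ) : ℝ :=
  1 + ∑' b : ℕ, 1152 * (8 * blockLength K * (b + 1)) ^ 2 * β ^ b

theorem summable_throughputConst (K : ℕ) {β : ℝ} (h0 : 0 ≤ β) (h1 : β < 1) :
    Summable fun b : ℕ => 1152 * (8 * blockLength K * (b + 1) : ℝ) ^ 2 * β ^ b := by
  have hβ : ‖β‖ < 1 := by rwa [Real.norm_eq_abs, abs_of_nonneg h0]
  have h := (((summable_pow_mul_geometric_of_norm_lt_one 2 hβ).add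
    ((summable_pow_mul_geometric_of_norm_lt_one 1 hβ).mul_left 2)).add
    (summable_geometric_of_norm_lt_one hβ)).mul_left (1152 * (8 * blockLength K : ℝ) ^ 2)
  refine h.congr fun b => ?_
  ring

/-- Splitting according to the number of blocks that fit between source and destination. -/
theorem ofReal_throughput_le {n m K : ℕ} {A ρ α P : ℝ} {p : Fin m → Sph} {color : Fin m → Fin K}
    {φ : ℝ → ℝ} {ω : Deployment n} {S : Plan n m} (hn : n ≠ 0) (hA : 0 < A)
    (hρ : IsDiskRadius n A ρ) (hp : IsTessellation n ρ p) (hP : 0 < P) (hα : 0 ≤ α)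
    (hφ : MonotoneOn φ (Set.Ici 0)) (hφ0 : ∀ x, 0 ≤ x → 0 ≤ φ x) (hφ1 : ∀ x, 0 ≤ x → φ x < 1)
    (hS : (∀ a, ∃ j, ω.1 j ∈ voronoiCell n p a) → S.Obeys p color ω) (hd : ∀ i, ω.2 i ≠ i)
    (i : Fin n) :
    ENNReal.ofReal (S.throughput φ P α color ω.1 i) ≤
      {ω : Deployment n | ∃ a, ∀ j, ω.1 j ∉ voronoiCell n p a}.indicator 1 ω +
      ∑' b : ℕ, ENNReal.ofReal (1 / A * φ (sinrBound K α) ^ b) *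
        {ω : Deployment n | surfDist n (ω.1 i) (ω.1 (ω.2 i)) ≤
          8 * blockLength K * (b + 1) * ρ}.indicator 1 ω := by
  by_cases hE : ∃ a, ∀ j, ω.1 j ∉ voronoiCell n p a
  · refine le_add_right ?_
    rw [Set.indicator_of_mem (by exact hE), Pi.one_apply, ENNReal.ofReal_le_one]
    exact throughput_le_one hφ0 hφ1 S color ω.1 i
  · push Not at hE
    refine le_add_left ?_
    have hρ0 := diskRadius_pos hn hA hρ
    have hN : (0 : ℝ) < 8 * blockLength K * ρ := by
      have := blockLength_pos K
      positivity
    have hex : ∃ b : ℕ,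
        surfDist n (ω.1 i) (ω.1 (ω.2 i)) ≤ 8 * blockLength K * (b + 1) * ρ := by
      obtain ⟨b, hb⟩ := exists_nat_ge (surfDist n (ω.1 i) (ω.1 (ω.2 i)) /
        (8 * blockLength K * ρ))
      rw [div_le_iff₀ hN] at hb
      exact ⟨b, by nlinarith⟩
    classical
    -- the least such `b` is the number of complete blocks that the packets have to pass
    have hle := Nat.find_spec hex
    have hmin := fun b => Nat.find_min hex (m := b)
    set b := Nat.find hex
    refine le_trans ?_ (ENNReal.le_tsum b)
    rw [Set.indicator_of_mem (by exact hle), Pi.one_apply, mul_one]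
    refine ENNReal.ofReal_le_ofReal
      (throughput_le_of_lt_surfDist hn hA hρ hp hP hα hφ hφ0 hφ1 (hS hE) hd i b ?_)
    rcases Nat.eq_zero_or_pos b with hb | hb
    · exact Or.inl hb
    · right
      have h := hmin (b - 1) (by omega)
      rw [not_le, Nat.cast_sub hb, Nat.cast_one, sub_add_cancel] at h
      exact h

/-- The square of the radius cancels the injection rate: `b` blocks or fewer separate source and
destination with probability of order `(b + 1) ^ 2 * A / n`, and the rate is at most `1 / A`. -/
theorem lintegral_throughput_le {n m K : ℕ} {A ρ α P : ℝ} {p : Fin m → Sph}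
    {color : Fin m → Fin K} {φ : ℝ → ℝ} {S : Deployment n → Plan n m} (hn : 2 ≤ n) (hA : 1 ≤ A)
    (hAn : 2 * Real.log n ≤ A) (hρ : IsDiskRadius n A ρ) (hp : IsTessellation n ρ p) (hP : 0 < P)
    (hα : 0 ≤ α) (hφ : MonotoneOn φ (Set.Ici 0)) (hφ0 : ∀ x, 0 ≤ x → 0 ≤ φ x)
    (hφ1 : ∀ x, 0 ≤ x → φ x < 1)
    (hS : ∀ᵐ ω ∂deploymentLaw n,
      (∀ a, ∃ j, ω.1 j ∈ voronoiCell n p a) → (S ω).Obeys p color ω) (i : Fin n) :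
    ∫⁻ ω, ENNReal.ofReal ((S ω).throughput φ P α color ω.1 i) ∂deploymentLaw n ≤
      ENNReal.ofReal (throughputConst K (φ (sinrBound K α)) / n) := by
  have hn0 : n ≠ 0 := by omega
  have hnpos : (0 : ℝ) < n := by positivity
  have hA0 : 0 < A := by linarith
  set β := φ (sinrBound K α) with hβ
  have hβ0 : 0 ≤ β := hφ0 _ (sinrBound_nonneg K α)
  have hβ1 : β < 1 := hφ1 _ (sinrBound_nonneg K α)
  have hN : (1 : ℝ) ≤ blockLength K := by exact_mod_cast blockLength_pos K
  set E := {ω : Deployment n | ∃ a, ∀ j, ω.1 j ∉ voronoiCell n p a}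
  set G : ℕ → Set (Deployment n) := fun b =>
    {ω | surfDist n (ω.1 i) (ω.1 (ω.2 i)) ≤ 8 * blockLength K * (b + 1) * ρ}
  have hEm : MeasurableSet E := measurableSet_exists_empty_cell p
  have hGm : ∀ b, MeasurableSet (G b) := fun b => measurableSet_surfDist_dest_le i _
  -- an empty cell has probability at most `n * exp (-2 log n) = 1 / n`
  have hE : deploymentLaw n E ≤ ENNReal.ofReal (1 / n) := by
    refine (measure_exists_empty_cell_le hn hA0.le hρ hp).trans ?_
    rw [← ENNReal.ofReal_natCast, ← ENNReal.ofReal_mul (by positivity)]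
    refine ENNReal.ofReal_le_ofReal ?_
    have hm : (m : ℝ) ≤ n := (le_mul_of_one_le_right (Nat.cast_nonneg m) hA).trans
      (card_cells_mul_le hn0 hρ hp)
    have hexp : Real.exp (-A) ≤ ((n : ℝ) ^ 2)⁻¹ := by
      rw [Real.exp_neg]
      refine inv_anti₀ (by positivity) ?_
      rw [← Real.exp_log (pow_pos hnpos 2), Real.log_pow]
      exact Real.exp_le_exp.2 (by exact_mod_cast hAn)
    calc (m : ℝ) * Real.exp (-A) ≤ n * ((n : ℝ) ^ 2)⁻¹ :=
          mul_le_mul hm hexp (Real.exp_pos _).le hnpos.le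
      _ = 1 / n := by field_simp
  have hG : ∀ b, ENNReal.ofReal (1 / A * β ^ b) * deploymentLaw n (G b) ≤
      ENNReal.ofReal (1152 * (8 * blockLength K * (b + 1)) ^ 2 * β ^ b / n) := by
    intro b
    have hR : (1 : ℝ) ≤ 8 * blockLength K * (b + 1) := by
      have hb : (0 : ℝ) ≤ b := Nat.cast_nonneg b
      nlinarith
    refine (mul_le_mul_right
      (measure_surfDist_dest_le hn i (uniformSph_disk_mul_le hn0 hρ hR)) _).trans ?_
    rw [← ENNReal.ofReal_mul (by positivity)]
    refine ENNReal.ofReal_le_ofReal (le_of_eq ?_)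
    field_simp
  have hsum := (summable_throughputConst K hβ0 hβ1).div_const (n : ℝ)
  calc _ ≤ ∫⁻ ω, (E.indicator 1 ω + ∑' b : ℕ, ENNReal.ofReal (1 / A * β ^ b) *
        (G b).indicator 1 ω) ∂deploymentLaw n := by
        refine lintegral_mono_ae ?_
        filter_upwards [hS, ae_dest_ne hn] with ω hω hd
        exact ofReal_throughput_le hn0 hA0 hρ hp hP hα hφ hφ0 hφ1 hω hd i
    _ = deploymentLaw n E + ∑' b : ℕ, ENNReal.ofReal (1 / A * β ^ b) * deploymentLaw n (G b) := by
        rw [lintegral_add_left (measurable_one.indicator hEm), lintegral_indicator_one hEm,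
          lintegral_tsum fun b =>
            ((measurable_one.indicator (hGm b)).const_mul _).aemeasurable]
        congr 2
        funext b
        rw [lintegral_const_mul _ (measurable_one.indicator (hGm b)),
          lintegral_indicator_one (hGm b)]
    _ ≤ ENNReal.ofReal (1 / n) + ∑' b : ℕ,
        ENNReal.ofReal (1152 * (8 * blockLength K * (b + 1)) ^ 2 * β ^ b / n) :=
        add_le_add hE (ENNReal.tsum_le_tsum hG)
    _ = ENNReal.ofReal (throughputConst K β / n) := by
        rw [← ENNReal.ofReal_tsum_of_nonneg (fun b => by positivity) hsum,
          ← ENNReal.ofReal_add (by positivity) (tsum_nonneg fun b => by positivity),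
          tsum_div_const, throughputConst, add_div]

theorem proposition3 (α : ℝ) (hα : 2 < α) (Δ : ℝ) (hΔ : 0 < Δ) (K : ℕ)
    (φ : ℝ → ℝ) (hφ_cont : ContinuousOn φ (Set.Ici 0)) (hφ_mono : MonotoneOn φ (Set.Ici 0))
    (hφ_nonneg : ∀ x, 0 ≤ x → 0 ≤ φ x) (hφ_lt_one : ∀ x, 0 ≤ x → φ x < 1)
    (hφ_lim : Tendsto φ atTop (𝓝 1)) :
    ∃ C : ℝ, ∀ᶠ n : ℕ in atTop,
      ∀ ρ : ℝ, IsDiskRadius n (100 * Real.log n) ρ →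
      ∀ (m : ℕ) (p : Fin m → Sph), IsTessellation n ρ p →
      ∀ color : Fin m → Fin K, IsInterferenceColoring n ρ Δ p color →
      ∀ P : ℝ, 0 < P →
      ∀ S : Deployment n → Plan n m,
        (∀ᵐ ω ∂deploymentLaw n,
          (∀ a, ∃ j, ω.1 j ∈ voronoiCell n p a) → (S ω).Obeys p color ω) →
        ∀ i : Fin n,
          ∫⁻ ω, ENNReal.ofReal ((S ω).throughput φ P α color ω.1 i) ∂deploymentLaw n ≤
            ENNReal.ofReal (C / n) := by
  refine ⟨throughputConst K (φ (sinrBound K α)), ?_⟩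
  filter_upwards [eventually_ge_atTop 3] with n hn
  intro ρ hρ m p hp color _ P hP S hS i
  have hlog : 1 ≤ Real.log n := by
    rw [Real.le_log_iff_exp_le (by positivity)]
    have h3 : (3 : ℝ) ≤ n := by exact_mod_cast hn
    linarith [Real.exp_one_lt_d9]
  exact lintegral_throughput_le (by omega) (by linarith) (by linarith) hρ hp hP (by linarith)
    hφ_mono hφ_nonneg hφ_lt_one hS i
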